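/- Let $X$ be a real random variable with distribution function $F$, let $F^{-1}(u)=\inf\{x\in\mathbb{R}: F(x)\ge u\}$ for $u\in(0,1)$, fix $p\in(0,1)$, and put $\xi_p=F^{-1}(p)$. Assume: (C1) $\int_p^1 F^{-1}(u)\,du<\infty$; (C2) $\mathbf{E}\big(|X|^{\varepsilon}\,\mathbf{1}_{\{X\le \xi_p\}}\big)<\infty$ for some $\varepsilon>0$. Assume further that in a neighborhood of $\xi_p$ the random variable $X$ has a probability density function $f$ which is continuous there, and that $f(\xi_p)>0$. Let $T_p=\frac{1}{1-p}\int_p^1F^{-1}(u)\,du$ be the Tail Value-at-Risk (TVaR) of $X$ at level $p$. Let $X_1,X_2,\ldots$ be independent copies of $X$, let $\widehat F_n(x)=\frac1n\sum_{i=1}^n\mathbf{1}_{\{X_i\le x\}}$, $\widehat F_n^{-1}(u)=\inf\{x\in\mathbb{R}:\widehat F_n(x)\ge u\}$, and let $$\widehat T_{n,p}=\frac1{1-p}\int_p^1\widehat F_n^{-1}(u)\,du$$ be the empirical TVaR. Then $\widehat T_{n,p}$ is integrable for all sufficiently large $n$, and its bias $B_n=\mathbf{E}(\widehat T_{n,p})-T_p$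 satisfies $$B_n=-\frac{p}{2nf(\xi_p)}+o\big(n^{-1}\big)\qquad(n\to\infty).$$ -/

import Mathlib

open Filter Topology MeasureTheory ProbabilityTheory Asymptotics

noncomputable section

namespace EmpTVaR

/-- The left-continuous inverse `u ↦ inf {x : F x ≥ u}` of a distribution function `F`
(meaningful for `u ∈ (0, 1)`). -/
def quantile (F : ℝ → ℝ) (u : ℝ) : ℝ :=
  sInf {x : ℝ | u ≤ F x}

/-- The Tail Value-at-Risk at level `p` of the distribution function `F`. -/
def tvar (F : ℝ → ℝ) (p : ℝ) : ℝ :=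
  (1 / (1 - p)) * ∫ u in Set.Ioo p 1, quantile F u

/-- The empirical distribution function of the data `x₁, …, xₙ`. -/
def empCDF {n : ℕ} (x : Fin n → ℝ) (t : ℝ) : ℝ :=
  (1 / (n : ℝ)) * ∑ i : Fin n, if x i ≤ t then (1 : ℝ) else 0

/-- The empirical TVaR at level `p` of the data `x₁, …, xₙ`. -/
def empTVaR (p : ℝ) {n : ℕ} (x : Fin n → ℝ) : ℝ :=
  tvar (empCDF x) p

/-- The function `f` is a probability density of the law `μ` on the set `U`. -/
def HasDensityOn (μ : Measure ℝ) (f : ℝ → ℝ) (U : Set ℝ) : Prop :=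
  (∀ x ∈ U, 0 ≤ f x) ∧
    ∀ A : Set ℝ, MeasurableSet A → A ⊆ U → μ A = ∫⁻ x in A, ENNReal.ofReal (f x)

/-- The bias of the empirical TVaR computed from the first `n` observations of the sequence
`S`, as an estimator of the TVaR of the distribution function `F`. -/
def bias {Ω : Type*} [MeasurableSpace Ω] (P : Measure Ω) (S : ℕ → Ω → ℝ) (F : ℝ → ℝ)
    (p : ℝ) (n : ℕ) : ℝ :=
  (∫ ω, empTVaR p (fun i : Fin n => S i ω) ∂P) - tvar F p

end EmpTVaR

end

/-! By the layer-cake formula (`tvar_eq`), for any distribution function `G` and threshold `a`, `(1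
- p) (TVaR - a)` is the integral of `1 - max p (G x)` over `x > a` minus that of `(G x - p)⁺` over
`x < a`. Apply this with `a = ξ` to `F` and to the empirical distribution function, whose value at
`x` is a binomial proportion with parameters `n` and `F x`. Taking expectations under the integral,
each `x` contributes minus the Jensen gap of `y ↦ (p - y)⁺`, so the bias is exactly `-(1 / (1 - p))
∫ gap n p (F x) dx` (`integral_empTVaR`).

The gap concentrates at `u = p`. Away from `p`, Chernoff's bound makes it geometrically small, with
a spare factor `(2 u ^ p) ^ K` (`exists_gap_le`); the two moment conditions make such factors
integrable in the tails, so the tails contribute `o(1 / n)`.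

Near `ξ`, substitute `u = F x`, where `dx` is about `du / f(ξ)` by continuity of `f`. The remaining
integral of the gap over `[0, 1]` is explicit, since every binomial probability integrates to `1 /
(n + 1)` (`integral_gap`), and `n` times it tends to `p (1 - p) / 2`. Hence `n` times the bias tends
to `-p / (2 f(ξ))`. -/

namespace EmpTVaR

/-! ### Binomial probabilities as Bernstein polynomials -/

/-- The probability that a binomial variable with parameters `n` and `u` equals `k`. -/
def bern (n k : ℕ) (u : ℝ) : ℝ := n.choose k * u ^ k * (1 - u) ^ (n - k)

lemma bern_eq_eval (n k : ℕ) (u : ℝ) : bern n k u = (bernsteinPolynomial ℝ n k).eval u := by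
  simp [bern, bernsteinPolynomial]

lemma continuous_bern (n k : ℕ) : Continuous (bern n k) := by
  unfold bern; fun_prop

lemma bern_nonneg (n k : ℕ) {u : ℝ} (h0 : 0 ≤ u) (h1 : u ≤ 1) : 0 ≤ bern n k u := by
  have : 0 ≤ 1 - u := by linarith
  unfold bern; positivity

lemma sum_bern (n : ℕ) (u : ℝ) : ∑ k ∈ Finset.range (n + 1), bern n k u = 1 := by
  simp_rw [bern_eq_eval, ← Polynomial.eval_finsetSum, bernsteinPolynomial.sum]
  simp

lemma sum_mul_bern (n : ℕ) (u : ℝ) : ∑ k ∈ Finset.range (n + 1), bern n k u * k = n * u := by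
  have h := congrArg (Polynomial.eval u) (bernsteinPolynomial.sum_smul ℝ n)
  simp only [Polynomial.eval_finsetSum, nsmul_eq_mul, Polynomial.eval_mul,
    Polynomial.eval_natCast, Polynomial.eval_X, ← bern_eq_eval] at h
  rw [← h]
  exact Finset.sum_congr rfl fun k _ => mul_comm _ _

lemma sum_bern_mul_pow (n : ℕ) (u z : ℝ) :
    ∑ k ∈ Finset.range (n + 1), bern n k u * z ^ k = (1 - u + u * z) ^ n := by
  rw [add_comm (1 - u), add_pow]
  refine Finset.sum_congr rfl fun k _ => ?_
  rw [bern, mul_pow]; ring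

/-- The integrand is, up to the factor `n + 1`, the derivative of the Bernstein polynomial with
indices `n + 1`, `k + 1`, whose endpoint values both vanish unless `k = n`. -/
lemma integral_bern_sub_succ (n k : ℕ) (hk : k ≤ n) :
    (∫ u in (0 : ℝ)..1, bern n k u) - (∫ u in (0 : ℝ)..1, bern n (k + 1) u)
      = if k = n then 1 / ((n : ℝ) + 1) else 0 := by
  have hd : ∀ u ∈ Set.uIcc (0 : ℝ) 1, HasDerivAt (bern (n + 1) (k + 1))
      (((n : ℝ) + 1) * (bern n k u - bern n (k + 1) u)) u := by
    intro u _
    have h := (bernsteinPolynomial ℝ (n + 1) (k + 1)).hasDerivAt u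
    rw [bernsteinPolynomial.derivative_succ] at h
    simp only [Polynomial.eval_mul, Polynomial.eval_sub, add_tsub_cancel_right,
      ← bern_eq_eval] at h
    rw [Polynomial.eval_natCast, Nat.cast_succ] at h
    exact h
  have hc : Continuous fun u => ((n : ℝ) + 1) * (bern n k u - bern n (k + 1) u) :=
    continuous_const.mul ((continuous_bern _ _).sub (continuous_bern _ _))
  have hi := intervalIntegral.integral_eq_sub_of_hasDerivAt hd (hc.intervalIntegrable _ _)
  rw [intervalIntegral.integral_const_mul, intervalIntegral.integral_sub
    ((continuous_bern _ _).intervalIntegrable _ _)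
    ((continuous_bern _ _).intervalIntegrable _ _)] at hi
  have hn : ((n : ℝ) + 1) ≠ 0 := by positivity
  rw [eq_comm, ← mul_right_inj' hn, hi]
  split_ifs with h
  · subst h; simp [bern]; field_simp
  · have : n - k ≠ 0 := by omega
    simp [bern, this]

lemma integral_bern (n k : ℕ) (hk : k ≤ n) :
    ∫ u in (0 : ℝ)..1, bern n k u = 1 / ((n : ℝ) + 1) := by
  -- The integrals agree for all `k ≤ n`; the value is read off at `k = n`, where the next binomial
  -- coefficient is zero.
  induction hk using Nat.decreasingInduction with
  | self =>
    have h := integral_bern_sub_succ n n le_rfl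
    have h0 : bern n (n + 1) = fun _ => 0 := by funext u; simp [bern]
    simpa [h0] using h
  | of_succ k hk ih =>
    have h := integral_bern_sub_succ n k hk.le
    rw [if_neg hk.ne, ih] at h
    linarith

/-! ### The Jensen gap of a binomial proportion -/

/-- The expectation of `(B / n - p)⁺` for a binomial variable `B` with parameters `n`, `u`. -/
noncomputable def excess (n : ℕ) (p u : ℝ) : ℝ :=
  ∑ k ∈ Finset.range (n + 1), bern n k u * max ((k : ℝ) / n - p) 0

/-- The expectation of `(p - B / n)⁺` for a binomial variable `B` with parameters `n`, `u`. -/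
noncomputable def deficit (n : ℕ) (p u : ℝ) : ℝ :=
  ∑ k ∈ Finset.range (n + 1), bern n k u * max (p - (k : ℝ) / n) 0

/-- The gap in Jensen's inequality for `y ↦ (p - y)⁺` and a binomial proportion. -/
noncomputable def gap (n : ℕ) (p u : ℝ) : ℝ := deficit n p u - max (p - u) 0

/-- Positive and negative parts differ by the affine function `p - y`, and a binomial proportion has
mean `u`. So the gap is the excess to the left of `p` and the deficit to the right. -/
lemma deficit_sub_excess {n : ℕ} (hn : n ≠ 0) (p u : ℝ) :
    deficit n p u - excess n p u = p - u := by
  have hn' : (n : ℝ) ≠ 0 := by exact_mod_cast hn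
  have h : ∀ k ∈ Finset.range (n + 1),
      bern n k u * max (p - (k : ℝ) / n) 0 - bern n k u * max ((k : ℝ) / n - p) 0
        = p * bern n k u - (1 / (n : ℝ)) * (bern n k u * k) := by
    intro k _
    have : max (p - (k : ℝ) / n) 0 - max ((k : ℝ) / n - p) 0 = p - k / n := by
      rcases le_total p ((k : ℝ) / n) with h | h
      · rw [max_eq_right (by linarith), max_eq_left (by linarith)]; ring
      · rw [max_eq_left (by linarith), max_eq_right (by linarith)]; ring
    rw [← mul_sub, this]; ring
  rw [deficit, excess, ← Finset.sum_sub_distrib, Finset.sum_congr rfl h,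
    Finset.sum_sub_distrib, ← Finset.mul_sum, ← Finset.mul_sum, sum_bern, sum_mul_bern]
  field_simp

lemma gap_eq_excess {n : ℕ} (hn : n ≠ 0) {p u : ℝ} (hu : u ≤ p) : gap n p u = excess n p u := by
  have := deficit_sub_excess hn p u
  rw [gap, max_eq_left (by linarith)]; linarith

lemma gap_eq_deficit (n : ℕ) {p u : ℝ} (hu : p ≤ u) : gap n p u = deficit n p u := by
  rw [gap, max_eq_right (by linarith), sub_zero]

lemma excess_nonneg (n : ℕ) (p : ℝ) {u : ℝ} (h0 : 0 ≤ u) (h1 : u ≤ 1) : 0 ≤ excess n p u :=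
  Finset.sum_nonneg fun k _ => mul_nonneg (bern_nonneg n k h0 h1) (le_max_right _ _)

lemma deficit_nonneg (n : ℕ) (p : ℝ) {u : ℝ} (h0 : 0 ≤ u) (h1 : u ≤ 1) : 0 ≤ deficit n p u :=
  Finset.sum_nonneg fun k _ => mul_nonneg (bern_nonneg n k h0 h1) (le_max_right _ _)

lemma gap_nonneg {n : ℕ} (hn : n ≠ 0) (p : ℝ) {u : ℝ} (h0 : 0 ≤ u) (h1 : u ≤ 1) :
    0 ≤ gap n p u := by
  rcases le_total u p with h | h
  · rw [gap_eq_excess hn h]; exact excess_nonneg n p h0 h1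
  · rw [gap_eq_deficit n h]; exact deficit_nonneg n p h0 h1

lemma continuous_deficit (n : ℕ) (p : ℝ) : Continuous (deficit n p) :=
  continuous_finsetSum _ fun k _ => (continuous_bern n k).mul continuous_const

lemma continuous_gap (n : ℕ) (p : ℝ) : Continuous (gap n p) :=
  (continuous_deficit n p).sub (by fun_prop)

lemma deficit_eq_excess_reflect {n : ℕ} (hn : n ≠ 0) (p u : ℝ) :
    deficit n p u = excess n (1 - p) (1 - u) := by
  have hn' : (n : ℝ) ≠ 0 := by exact_mod_cast hn
  rw [deficit, excess, ← Finset.sum_range_reflect]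
  refine Finset.sum_congr rfl fun k hk => ?_
  have hk' : k ≤ n := by simpa [Nat.lt_succ_iff] using hk
  have e : n + 1 - 1 - k = n - k := by omega
  have e2 : n - (n - k) = k := by omega
  rw [e, bern, bern, Nat.choose_symm hk', e2, Nat.cast_sub hk']
  have : p - ((n : ℝ) - k) / n = k / n - (1 - p) := by field_simp; ring
  rw [this]; ring

/-- Exchanging successes and failures turns a deficit into an excess; upper-tail estimates thus
follow from lower-tail ones. -/
lemma gap_reflect {n : ℕ} (hn : n ≠ 0) (p u : ℝ) : gap n p u = gap n (1 - p) (1 - u) := by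
  rcases le_total u p with h | h
  · rw [gap_eq_excess hn h, gap_eq_deficit n (by linarith), deficit_eq_excess_reflect hn]
    simp
  · rw [gap_eq_deficit n h, gap_eq_excess hn (by linarith), deficit_eq_excess_reflect hn]

/-! ### Geometric smallness of the gap away from `p` -/

/-- Chernoff's bound for the expected excess. -/
lemma excess_le_chernoff {n : ℕ} (hn : n ≠ 0) {p u z : ℝ} (hp : 0 ≤ p) (h0 : 0 ≤ u) (h1 : u ≤ 1)
    (hz : 1 ≤ z) : excess n p u ≤ (z ^ (-p) * (1 - u + u * z)) ^ n := by
  have hn' : (0 : ℝ) < n := by exact_mod_cast Nat.pos_of_ne_zero hn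
  have hz0 : 0 < z := by linarith
  rw [mul_pow, ← sum_bern_mul_pow, Finset.mul_sum]
  refine Finset.sum_le_sum fun k hk => ?_
  have hk' : k ≤ n := by simpa [Nat.lt_succ_iff] using hk
  have hb := bern_nonneg n k h0 h1
  have key : max ((k : ℝ) / n - p) 0 ≤ (z ^ (-p)) ^ n * z ^ k := by
    have hpos : 0 ≤ (z ^ (-p)) ^ n * z ^ k := by positivity
    refine max_le ?_ hpos
    rcases le_total ((k : ℝ) / n) p with h | h
    · linarith
    · have hkn : (k : ℝ) / n ≤ 1 := by
        rw [div_le_one hn']; exact_mod_cast hk'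
      have : (1 : ℝ) ≤ (z ^ (-p)) ^ n * z ^ k := by
        rw [← Real.rpow_natCast, ← Real.rpow_mul hz0.le, ← Real.rpow_natCast z k,
          ← Real.rpow_add hz0]
        refine Real.one_le_rpow hz ?_
        rw [le_div_iff₀ hn'] at h
        linarith
      linarith
  calc bern n k u * max ((k : ℝ) / n - p) 0 ≤ bern n k u * ((z ^ (-p)) ^ n * z ^ k) :=
        mul_le_mul_of_nonneg_left key hb
    _ = _ := by ring

/-- Take `z = exp c`. With `exp c - 1 ≤ c + c ^ 2` and `1 + y ≤ exp y`, the exponent is at most `-(1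
- p) c ^ 2 - c ^ 3 < 0`. -/
lemma exists_chernoff_rate {p c : ℝ} (hp : p < 1) (hc : 0 < c) (hcp : c ≤ p) :
    ∃ ρ : ℝ, 0 < ρ ∧ ρ < 1 ∧ ∃ z : ℝ, 1 ≤ z ∧ ∀ u, u ≤ p - c →
      z ^ (-p) * (1 - u + u * z) ≤ ρ := by
  have hc1 : c < 1 := by linarith
  refine ⟨Real.exp (-p * c + (p - c) * (c + c ^ 2)), Real.exp_pos _, ?_, Real.exp c,
    Real.one_le_exp hc.le, fun u hu => ?_⟩
  · rw [Real.exp_lt_one_iff]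
    nlinarith [mul_pos hc hc]
  · have h1 := abs_le.1 (Real.abs_exp_sub_one_sub_id_le (x := c) (by rw [abs_of_pos hc]; exact hc1.le))
    have h2 : Real.exp c - 1 ≤ c + c ^ 2 := by linarith [h1.2]
    have h3 : 0 ≤ Real.exp c - 1 := by linarith [Real.one_le_exp hc.le]
    rw [← Real.exp_mul, Real.exp_add, show c * -p = -p * c by ring]
    refine mul_le_mul_of_nonneg_left ?_ (Real.exp_pos _).le
    have h4 : 1 - u + u * Real.exp c ≤ (p - c) * (c + c ^ 2) + 1 := by
      nlinarith [mul_le_mul_of_nonneg_right hu h3, mul_le_mul_of_nonneg_left h2 (sub_nonneg.2 hcp)]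
    exact h4.trans (Real.add_one_le_exp _)

/-- Away from `p` the gap is geometrically small, with an additional polynomial factor. -/
lemma exists_gap_le {p c : ℝ} (hp0 : 0 < p) (hp : p < 1) (hc : 0 < c) (hcp : c ≤ p) :
    ∃ ρ : ℝ, 0 < ρ ∧ ρ < 1 ∧ ∀ n K : ℕ, n ≠ 0 → K ≤ n → ∀ u, 0 ≤ u → u ≤ p - c →
      gap n p u ≤ ρ ^ (n - K) * (2 * u ^ p) ^ K := by
  obtain ⟨ρ, h0, h1, z, hz, hρ⟩ := exists_chernoff_rate hp hc hcp
  refine ⟨ρ, h0, h1, fun n K hn hK u hu huc => ?_⟩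
  have hu1 : u ≤ 1 := by linarith
  rw [gap_eq_excess hn (by linarith)]
  have hz0 : 0 < z := by linarith
  have hup : 0 ≤ 2 * u ^ p := by positivity
  have e1 : excess n p u ≤ ρ ^ n :=
    (excess_le_chernoff hn hp0.le hu hu1 hz).trans (pow_le_pow_left₀
      (mul_nonneg (by positivity) (by nlinarith)) (hρ u huc) n)
  -- Chernoff with `z = 1 / u` gives decay as `u → 0`, which the uniform rate `ρ` does not provide.
  have e2 : excess n p u ≤ (2 * u ^ p) ^ n := by
    rcases hu.eq_or_lt with rfl | hu'
    · have : excess n p 0 = 0 := by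
        refine Finset.sum_eq_zero fun k _ => ?_
        rcases Nat.eq_zero_or_pos k with rfl | hk
        · simp [hp0.le]
        · simp [bern, hk.ne']
      rw [this]; positivity
    · refine (excess_le_chernoff hn hp0.le hu hu1 (z := u⁻¹) ((one_le_inv₀ hu').2 hu1)).trans ?_
      have hup' : 0 < u ^ p := by positivity
      rw [Real.inv_rpow hu, Real.rpow_neg hu, inv_inv, mul_inv_cancel₀ hu'.ne']
      exact pow_le_pow_left₀ (mul_nonneg hup'.le (by linarith)) (by nlinarith) n
  -- Start from the smaller of the two bounds and enlarge only the factors that need it.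
  rcases le_total ρ (2 * u ^ p) with h | h
  · calc _ ≤ ρ ^ n := e1
      _ = ρ ^ (n - K) * ρ ^ K := by rw [← pow_add, Nat.sub_add_cancel hK]
      _ ≤ _ := by gcongr
  · calc _ ≤ (2 * u ^ p) ^ n := e2
      _ = (2 * u ^ p) ^ (n - K) * (2 * u ^ p) ^ K := by rw [← pow_add, Nat.sub_add_cancel hK]
      _ ≤ _ := by gcongr

/-! ### The exact integral of the gap over `[0, 1]` -/

lemma sum_pos_part {n : ℕ} (hn : n ≠ 0) {p : ℝ} (hp0 : 0 ≤ p) (hp1 : p ≤ 1) :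
    ∑ k ∈ Finset.range (n + 1), max (p - (k : ℝ) / n) 0
      = (n * p - Int.fract (n * p) + 1) * (n * p + Int.fract (n * p)) / (2 * n) := by
  have hn' : (0 : ℝ) < n := by exact_mod_cast Nat.pos_of_ne_zero hn
  set m := ⌊(n : ℝ) * p⌋₊ with hm
  have hnp : 0 ≤ (n : ℝ) * p := by positivity
  have hfr : Int.fract ((n : ℝ) * p) = n * p - m := by
    rw [Int.fract, hm, natCast_floor_eq_intCast_floor hnp]
  have hmn : m ≤ n := by
    rw [hm]; exact Nat.floor_le_of_le (by nlinarith)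
  have hsub : Finset.range (m + 1) ⊆ Finset.range (n + 1) :=
    Finset.range_subset_range.2 (by omega)
  -- Only the indices `k ≤ ⌊n p⌋` contribute, which leaves an arithmetic progression.
  rw [← Finset.sum_subset hsub]
  · have h : ∀ k ∈ Finset.range (m + 1), max (p - (k : ℝ) / n) 0 = p - (1 / n : ℝ) * k := by
      intro k hk
      have hk' : k ≤ m := by simpa [Nat.lt_succ_iff] using hk
      have : (k : ℝ) ≤ n * p := (Nat.le_floor_iff hnp).1 hk'
      have h2 : (k : ℝ) / n ≤ p := by rw [div_le_iff₀ hn']; linarith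
      rw [max_eq_left (by linarith)]; ring
    have hg : (∑ k ∈ Finset.range (m + 1), (k : ℝ)) = m * (m + 1) / 2 := by
      have := Finset.sum_range_id_mul_two (m + 1)
      have h2 : (∑ k ∈ Finset.range (m + 1), (k : ℝ)) * 2 = ((m : ℝ) + 1) * m := by
        have := congrArg (Nat.cast : ℕ → ℝ) this
        push_cast at this
        simpa using this
      linarith
    rw [Finset.sum_congr rfl h, Finset.sum_sub_distrib, ← Finset.mul_sum, hg, hfr]
    simp only [Finset.sum_const, Finset.card_range, nsmul_eq_mul]
    push_cast
    field_simp
    ring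
  · intro k _ hk
    have hk' : m < k := by simpa using hk
    have : (n : ℝ) * p < k := (Nat.floor_lt hnp).1 hk'
    have h2 : p < (k : ℝ) / n := by rw [lt_div_iff₀ hn']; linarith
    exact max_eq_right (by linarith)

lemma integral_gap {n : ℕ} (hn : n ≠ 0) {p : ℝ} (hp0 : 0 ≤ p) (hp1 : p ≤ 1) :
    (n : ℝ) * ∫ u in (0 : ℝ)..1, gap n p u
      = (n * (p * (1 - p)) + Int.fract (n * p) - Int.fract (n * p) ^ 2) / (2 * (n + 1)) := by
  have hn' : (0 : ℝ) < n := by exact_mod_cast Nat.pos_of_ne_zero hn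
  have h1 : ∫ u in (0 : ℝ)..1, deficit n p u
      = (1 / ((n : ℝ) + 1)) * ∑ k ∈ Finset.range (n + 1), max (p - (k : ℝ) / n) 0 := by
    unfold deficit
    have hc : ∀ k, Continuous fun u => bern n k u * max (p - (k : ℝ) / n) 0 := fun k =>
      (continuous_bern n k).mul continuous_const
    rw [intervalIntegral.integral_finsetSum fun k _ => (hc k).intervalIntegrable _ _,
      Finset.mul_sum]
    refine Finset.sum_congr rfl fun k hk => ?_
    rw [intervalIntegral.integral_mul_const, integral_bern n k
      (by simpa [Nat.lt_succ_iff] using hk)]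
  have h2 : ∫ u in (0 : ℝ)..1, max (p - u) 0 = p ^ 2 / 2 := by
    have hc : Continuous fun u : ℝ => max (p - u) 0 := by fun_prop
    rw [← intervalIntegral.integral_add_adjacent_intervals (hc.intervalIntegrable 0 p)
      (hc.intervalIntegrable p 1)]
    have a1 : ∫ u in (0 : ℝ)..p, max (p - u) 0 = ∫ u in (0 : ℝ)..p, (p - u) := by
      refine intervalIntegral.integral_congr fun u hu => ?_
      rw [Set.uIcc_of_le hp0] at hu
      exact max_eq_left (by linarith [hu.2])
    have a2 : ∫ u in p..(1 : ℝ), max (p - u) 0 = ∫ u in p..(1 : ℝ), 0 := by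
      refine intervalIntegral.integral_congr fun u hu => ?_
      rw [Set.uIcc_of_le hp1] at hu
      exact max_eq_right (by linarith [hu.1])
    rw [a1, a2, intervalIntegral.integral_sub (by simp) (by simp)]
    simp
    ring
  have h3 : ∫ u in (0 : ℝ)..1, gap n p u
      = (∫ u in (0 : ℝ)..1, deficit n p u) - ∫ u in (0 : ℝ)..1, max (p - u) 0 := by
    have hc : Continuous fun u : ℝ => max (p - u) 0 := by fun_prop
    exact intervalIntegral.integral_sub ((continuous_deficit n p).intervalIntegrable _ _)
      (hc.intervalIntegrable _ _)
  rw [h3, h1, h2, sum_pos_part hn hp0 hp1]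
  field_simp
  ring

lemma tendsto_integral_gap {p : ℝ} (hp0 : 0 ≤ p) (hp1 : p ≤ 1) :
    Tendsto (fun n : ℕ => (n : ℝ) * ∫ u in (0 : ℝ)..1, gap n p u) atTop
      (𝓝 (p * (1 - p) / 2)) := by
  have hlim : Tendsto (fun n : ℕ => 1 / ((n : ℝ) + 1)) atTop (𝓝 0) :=
    tendsto_one_div_add_atTop_nhds_zero_nat
  refine tendsto_iff_norm_sub_tendsto_zero.2 (squeeze_zero' (Eventually.of_forall fun n => norm_nonneg _)
    ?_ hlim)
  filter_upwards [eventually_ne_atTop 0] with n hn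
  have hn' : (0 : ℝ) < n := by exact_mod_cast Nat.pos_of_ne_zero hn
  rw [integral_gap hn hp0 hp1, Real.norm_eq_abs]
  set θ := Int.fract ((n : ℝ) * p)
  have t0 : 0 ≤ θ := Int.fract_nonneg _
  have t1 : θ < 1 := Int.fract_lt_one _
  have e : (n * (p * (1 - p)) + θ - θ ^ 2) / (2 * ((n : ℝ) + 1)) - p * (1 - p) / 2
      = ((θ - θ ^ 2 - p * (1 - p)) / 2) * (1 / ((n : ℝ) + 1)) := by
    field_simp; ring
  have hpos : 0 < 1 / ((n : ℝ) + 1) := by positivity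
  rw [e, abs_mul, abs_of_pos hpos]
  have : |(θ - θ ^ 2 - p * (1 - p)) / 2| ≤ 1 := by
    rw [abs_le]; constructor <;> nlinarith
  nlinarith

/-! ### Distribution functions and their quantiles -/

/-- `G` is the distribution function of a probability measure on the line. -/
structure IsDistFun (G : ℝ → ℝ) : Prop where
  mono : Monotone G
  right_cont : ∀ x, ContinuousWithinAt G (Set.Ioi x) x
  bot : Tendsto G atBot (𝓝 0)
  top : Tendsto G atTop (𝓝 1)

lemma IsDistFun.le_one {G : ℝ → ℝ} (hG : IsDistFun G) (x : ℝ) : G x ≤ 1 :=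
  hG.mono.ge_of_tendsto hG.top x

lemma isDistFun_cdf (μ : Measure ℝ) : IsDistFun (fun x => cdf μ x) where
  mono := monotone_cdf μ
  right_cont x := ((cdf μ).right_continuous x).mono Set.Ioi_subset_Ici_self
  bot := tendsto_cdf_atBot μ
  top := tendsto_cdf_atTop μ

lemma isDistFun_empCDF {n : ℕ} (hn : n ≠ 0) (x : Fin n → ℝ) : IsDistFun (empCDF x) where
  mono := by
    intro s t hst
    unfold empCDF
    gcongr with i
    split_ifs with h1 h2 h2 <;> first | exact absurd (h1.trans hst) h2 | norm_num
  right_cont t := by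
    unfold empCDF
    refine ContinuousWithinAt.mul continuousWithinAt_const
      (tendsto_finsetSum _ fun i _ => ?_)
    rcases le_or_gt (x i) t with h | h
    · rw [if_pos h]
      refine tendsto_const_nhds.congr' ?_
      filter_upwards [self_mem_nhdsWithin] with s hs
      rw [if_pos (h.trans (le_of_lt hs))]
    · rw [if_neg h.not_ge]
      refine tendsto_const_nhds.congr' ?_
      filter_upwards [nhdsWithin_le_nhds (Iio_mem_nhds h)] with s hs
      rw [if_neg (not_le.2 hs)]
  bot := by
    have : Tendsto (empCDF x) atBot (𝓝 ((1 / (n : ℝ)) * ∑ i : Fin n, 0)) := by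
      refine Tendsto.const_mul _ (tendsto_finsetSum _ fun i _ => tendsto_const_nhds.congr' ?_)
      filter_upwards [eventually_lt_atBot (x i)] with s hs
      rw [if_neg (not_le.2 hs)]
    simpa using this
  top := by
    have hn' : (n : ℝ) ≠ 0 := by exact_mod_cast hn
    have : Tendsto (empCDF x) atTop (𝓝 ((1 / (n : ℝ)) * ∑ i : Fin n, 1)) := by
      refine Tendsto.const_mul _ (tendsto_finsetSum _ fun i _ => tendsto_const_nhds.congr' ?_)
      filter_upwards [eventually_ge_atTop (x i)] with s hs
      rw [if_pos hs]
    simpa [hn'] using this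

/-- The quantile function is the lower adjoint of the distribution function. -/
lemma quantile_le_iff {G : ℝ → ℝ} (hG : IsDistFun G) {u : ℝ} (h0 : 0 < u) (h1 : u < 1) (x : ℝ) :
    quantile G u ≤ x ↔ u ≤ G x := by
  have hbdd : BddBelow {x : ℝ | u ≤ G x} := by
    obtain ⟨y, hy⟩ := (hG.bot.eventually (gt_mem_nhds h0)).exists
    refine ⟨y, fun z hz => ?_⟩
    by_contra hzy
    exact absurd (hz.trans (hG.mono (not_le.1 hzy).le)) (not_le.2 hy)
  have hne : {x : ℝ | u ≤ G x}.Nonempty := by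
    obtain ⟨y, hy⟩ := (hG.top.eventually (lt_mem_nhds h1)).exists
    exact ⟨y, hy.le⟩
  have hq : u ≤ G (quantile G u) := by
    refine ge_of_tendsto (hG.right_cont (quantile G u)) ?_
    filter_upwards [self_mem_nhdsWithin] with y hy
    obtain ⟨a, ha, hay⟩ := exists_lt_of_csInf_lt hne hy
    exact le_trans ha (hG.mono hay.le)
  exact ⟨fun h => hq.trans (hG.mono h), fun h => csInf_le hbdd h⟩

lemma monotoneOn_quantile {G : ℝ → ℝ} (hG : IsDistFun G) :
    MonotoneOn (quantile G) (Set.Ioo 0 1) := by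
  intro u hu v hv huv
  rw [quantile_le_iff hG hu.1 hu.2]
  exact huv.trans ((quantile_le_iff hG hv.1 hv.2 _).1 le_rfl)

/-! ### Layer-cake formula for the Tail Value-at-Risk -/

/-- The integral over `(p, 1)` of the positive part of the quantile function minus `a`. -/
noncomputable def upperPart (G : ℝ → ℝ) (p a : ℝ) : ENNReal :=
  ∫⁻ x in Set.Ioi a, ENNReal.ofReal (1 - max p (G x))

/-- The integral over `(p, 1)` of the negative part of the quantile function minus `a`. -/
noncomputable def lowerPart (G : ℝ → ℝ) (p a : ℝ) : ENNReal :=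
  ∫⁻ x in Set.Iio a, ENNReal.ofReal (G x - p)

/-- By the adjunction, `(quantile G u - a)⁺` is the length of `{x > a : G x < u}`; Tonelli then
integrates over `u` first. -/
lemma lintegral_quantile_sub {G : ℝ → ℝ} (hG : IsDistFun G) {p : ℝ} (hp : 0 ≤ p) (a : ℝ) :
    ∫⁻ u in Set.Ioo p 1, ENNReal.ofReal (quantile G u - a) = upperPart G p a := by
  have hm : MeasurableSet {q : ℝ × ℝ | G q.2 < q.1} :=
    measurableSet_lt (hG.mono.measurable.comp measurable_snd) measurable_fst
  have h1 : ∀ u ∈ Set.Ioo p 1, ENNReal.ofReal (quantile G u - a)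
      = ∫⁻ x in Set.Ioi a, {q : ℝ × ℝ | G q.2 < q.1}.indicator 1 (u, x) := by
    intro u hu
    have hs : MeasurableSet {x : ℝ | G x < u} := measurableSet_lt hG.mono.measurable measurable_const
    have : ∀ x, {q : ℝ × ℝ | G q.2 < q.1}.indicator (1 : ℝ × ℝ → ENNReal) (u, x)
        = {x : ℝ | G x < u}.indicator 1 x := fun x => rfl
    simp_rw [this]
    rw [lintegral_indicator_one hs, Measure.restrict_apply hs]
    have : {x : ℝ | G x < u} ∩ Set.Ioi a = Set.Ioo a (quantile G u) := by
      ext x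
      have := quantile_le_iff hG (hp.trans_lt hu.1) hu.2 x
      simp only [Set.mem_inter_iff, Set.mem_ofPred_eq, Set.mem_Ioi, Set.mem_Ioo]
      rw [← not_le, ← this, not_le, and_comm]
    rw [this, Real.volume_Ioo]
  have h2 : ∀ x, ENNReal.ofReal (1 - max p (G x))
      = ∫⁻ u in Set.Ioo p 1, {q : ℝ × ℝ | G q.2 < q.1}.indicator 1 (u, x) := by
    intro x
    have hs : MeasurableSet (Set.Ioi (G x)) := measurableSet_Ioi
    have : ∀ u, {q : ℝ × ℝ | G q.2 < q.1}.indicator (1 : ℝ × ℝ → ENNReal) (u, x)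
        = (Set.Ioi (G x)).indicator 1 u := fun x => rfl
    simp_rw [this]
    rw [lintegral_indicator_one hs, Measure.restrict_apply hs]
    have : Set.Ioi (G x) ∩ Set.Ioo p 1 = Set.Ioo (max p (G x)) 1 := by
      ext u; simp only [Set.mem_inter_iff, Set.mem_Ioi, Set.mem_Ioo, max_lt_iff]; tauto
    rw [this, Real.volume_Ioo]
  rw [setLIntegral_congr_fun measurableSet_Ioo h1, upperPart, lintegral_lintegral_swap]
  · exact lintegral_congr fun x => (h2 x).symm
  · exact (measurable_one.indicator hm).aemeasurable

lemma lintegral_sub_quantile {G : ℝ → ℝ} (hG : IsDistFun G) {p : ℝ} (hp : 0 ≤ p) (a : ℝ) :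
    ∫⁻ u in Set.Ioo p 1, ENNReal.ofReal (a - quantile G u) = lowerPart G p a := by
  have hm : MeasurableSet {q : ℝ × ℝ | q.1 ≤ G q.2} :=
    measurableSet_le measurable_fst (hG.mono.measurable.comp measurable_snd)
  have h1 : ∀ u ∈ Set.Ioo p 1, ENNReal.ofReal (a - quantile G u)
      = ∫⁻ x in Set.Iio a, {q : ℝ × ℝ | q.1 ≤ G q.2}.indicator 1 (u, x) := by
    intro u hu
    have hs : MeasurableSet {x : ℝ | u ≤ G x} := measurableSet_le measurable_const hG.mono.measurable
    have : ∀ x, {q : ℝ × ℝ | q.1 ≤ G q.2}.indicator (1 : ℝ × ℝ → ENNReal) (u, x)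
        = {x : ℝ | u ≤ G x}.indicator 1 x := fun x => rfl
    simp_rw [this]
    rw [lintegral_indicator_one hs, Measure.restrict_apply hs]
    have : {x : ℝ | u ≤ G x} ∩ Set.Iio a = Set.Ico (quantile G u) a := by
      ext x
      have := quantile_le_iff hG (hp.trans_lt hu.1) hu.2 x
      simp only [Set.mem_inter_iff, Set.mem_ofPred_eq, Set.mem_Iio, Set.mem_Ico]
      rw [← this]
    rw [this, Real.volume_Ico]
  have h2 : ∀ x, ENNReal.ofReal (G x - p)
      = ∫⁻ u in Set.Ioo p 1, {q : ℝ × ℝ | q.1 ≤ G q.2}.indicator 1 (u, x) := by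
    intro x
    have hs : MeasurableSet (Set.Iic (G x)) := measurableSet_Iic
    have : ∀ u, {q : ℝ × ℝ | q.1 ≤ G q.2}.indicator (1 : ℝ × ℝ → ENNReal) (u, x)
        = (Set.Iic (G x)).indicator 1 u := fun x => rfl
    simp_rw [this]
    rw [lintegral_indicator_one hs, Measure.restrict_apply hs]
    -- The section contains its right endpoint only when `G x < 1`, so it is squeezed between an
    -- open and a half-open interval of equal length.
    refine le_antisymm ?_ ?_
    · rw [← Real.volume_Ioo]
      exact measure_mono fun u hu => ⟨hu.2.le, hu.1, hu.2.trans_le (hG.le_one x)⟩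
    · rw [← Real.volume_Ioc]
      exact measure_mono fun u hu => ⟨hu.2.1, hu.1⟩
  rw [setLIntegral_congr_fun measurableSet_Ioo h1, lowerPart, lintegral_lintegral_swap]
  · exact lintegral_congr fun x => (h2 x).symm
  · exact (measurable_one.indicator hm).aemeasurable

lemma aemeasurable_quantile {G : ℝ → ℝ} (hG : IsDistFun G) {p : ℝ} (hp : 0 ≤ p) :
    AEMeasurable (quantile G) (volume.restrict (Set.Ioo p 1)) :=
  aemeasurable_restrict_of_monotoneOn measurableSet_Ioo
    ((monotoneOn_quantile hG).mono (Set.Ioo_subset_Ioo_left hp))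

/-- The quantile integral behind the Tail Value-at-Risk, split at an arbitrary threshold. -/
lemma tvar_eq {G : ℝ → ℝ} (hG : IsDistFun G) {p : ℝ} (hp : 0 ≤ p) (hp1 : p < 1) (a : ℝ)
    (hu : upperPart G p a ≠ ⊤) (hl : lowerPart G p a ≠ ⊤) :
    tvar G p = a + (1 / (1 - p)) * ((upperPart G p a).toReal - (lowerPart G p a).toReal) := by
  have hm := aemeasurable_quantile hG hp
  have hint : IntegrableOn (fun u => quantile G u - a) (Set.Ioo p 1) := by
    refine ⟨(hm.sub_const a).aestronglyMeasurable, ?_⟩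
    rw [hasFiniteIntegral_iff_norm]
    have : ∀ u, ENNReal.ofReal ‖quantile G u - a‖
        = ENNReal.ofReal (quantile G u - a) + ENNReal.ofReal (a - quantile G u) := by
      intro u
      rw [Real.norm_eq_abs]
      rcases le_total (quantile G u) a with h | h
      · rw [abs_of_nonpos (by linarith), ENNReal.ofReal_of_nonpos (p := quantile G u - a) (by linarith),
          zero_add, neg_sub]
      · rw [abs_of_nonneg (by linarith), ENNReal.ofReal_of_nonpos (p := a - quantile G u) (by linarith),
          add_zero]
    simp_rw [this]
    rw [lintegral_add_left' (hm.sub_const a).ennreal_ofReal, lintegral_quantile_sub hG hp,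
      lintegral_sub_quantile hG hp]
    exact (ENNReal.add_lt_top.2 ⟨hu.lt_top, hl.lt_top⟩)
  have h1 := integral_eq_lintegral_pos_part_sub_lintegral_neg_part hint
  simp only [neg_sub] at h1
  rw [lintegral_quantile_sub hG hp, lintegral_sub_quantile hG hp] at h1
  have hconst : IntegrableOn (fun _ : ℝ => a) (Set.Ioo p 1) := by
    simp [integrableOn_const_iff]
  have h2 := integral_add hint hconst
  simp only [sub_add_cancel] at h2
  rw [tvar, h2, h1, setIntegral_const, Real.volume_real_Ioo_of_le hp1.le, smul_eq_mul]
  have : 1 - p ≠ 0 := by linarith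
  field_simp
  ring

lemma upperPart_ne_top {G : ℝ → ℝ} (hG : IsDistFun G) {p : ℝ} (hp : 0 ≤ p) (a : ℝ)
    (h : IntegrableOn (quantile G) (Set.Ioo p 1)) : upperPart G p a ≠ ⊤ := by
  rw [← lintegral_quantile_sub hG hp]
  have hconst : IntegrableOn (fun _ : ℝ => a) (Set.Ioo p 1) := by
    simp [integrableOn_const_iff]
  have h2 := (hasFiniteIntegral_iff_norm _).1 (h.sub hconst).2
  refine ((lintegral_mono fun u => ?_).trans_lt h2).ne
  exact ENNReal.ofReal_le_ofReal (Real.le_norm_self _)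

/-! ### Expectation over the sample and the exact bias -/

/-- The number of the data `x₁, …, xₙ` that are at most `t`. -/
noncomputable def countLE {n : ℕ} (x : Fin n → ℝ) (t : ℝ) : ℕ :=
  (Finset.univ.filter fun i => x i ≤ t).card

lemma empCDF_eq_countLE {n : ℕ} (x : Fin n → ℝ) (t : ℝ) : empCDF x t = countLE x t / n := by
  rw [empCDF, countLE, Finset.sum_boole]; ring

lemma measurable_empCDF (n : ℕ) :
    Measurable fun q : (Fin n → ℝ) × ℝ => empCDF q.1 q.2 := by
  unfold empCDF
  refine Measurable.const_mul (Finset.measurable_sum _ fun i _ => ?_) _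
  exact Measurable.ite (measurableSet_le (by fun_prop) measurable_snd) measurable_const
    measurable_const

/-- The number of observations up to `t` in a sample from `μ` has a binomial distribution. -/
lemma lintegral_countLE (μ : Measure ℝ) [IsProbabilityMeasure μ] (n : ℕ) (t : ℝ) (φ : ℕ → ℝ)
    (hφ : ∀ k, k ≤ n → 0 ≤ φ k) :
    ∫⁻ x, ENNReal.ofReal (φ (countLE x t)) ∂(Measure.pi fun _ : Fin n => μ)
      = ENNReal.ofReal (∑ k ∈ Finset.range (n + 1), bern n k (cdf μ t) * φ k) := by
  set u := cdf μ t with hu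
  have hu0 : 0 ≤ u := cdf_nonneg μ t
  have hu1 : 0 ≤ 1 - u := by linarith [cdf_le_one μ t]
  -- The boxes `B s` partition the sample space by the set `s` of indices whose observation is at
  -- most `t`; grouping by cardinality yields the binomial coefficients.
  let B : Finset (Fin n) → Set (Fin n → ℝ) := fun s =>
    Set.univ.pi fun i => if i ∈ s then Set.Iic t else Set.Ioi t
  have hB : ∀ s, MeasurableSet (B s) := fun s => by
    refine MeasurableSet.univ_pi fun i => ?_
    split_ifs
    exacts [measurableSet_Iic, measurableSet_Ioi]
  have hmem : ∀ x s, x ∈ B s ↔ s = Finset.univ.filter fun i => x i ≤ t := by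
    intro x s
    simp only [B, Set.mem_univ_pi]
    constructor
    · intro h
      ext i
      have := h i
      split_ifs at this with hi
      · simpa [hi] using this
      · simpa [hi] using this
    · rintro rfl i
      split_ifs with hi
      · simpa using hi
      · simpa using hi
  have hcard : ∀ s : Finset (Fin n), s.card ≤ n := fun s => by
    simpa using Finset.card_le_univ s
  have hμB : ∀ s, (Measure.pi fun _ : Fin n => μ) (B s)
      = ENNReal.ofReal (u ^ s.card * (1 - u) ^ (n - s.card)) := by
    intro s
    have h1 : μ (Set.Iic t) = ENNReal.ofReal u := (ofReal_cdf μ t).symm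
    have h2 : μ (Set.Ioi t) = ENNReal.ofReal (1 - u) := by
      rw [← Set.compl_Iic, prob_compl_eq_one_sub measurableSet_Iic, h1,
        ENNReal.ofReal_sub _ hu0, ENNReal.ofReal_one]
    rw [Measure.pi_pi]
    have : ∀ i, μ (if i ∈ s then Set.Iic t else Set.Ioi t)
        = if i ∈ s then ENNReal.ofReal u else ENNReal.ofReal (1 - u) := by
      intro i; split_ifs <;> assumption
    simp_rw [this]
    rw [Finset.prod_ite, Finset.prod_const, Finset.prod_const, ENNReal.ofReal_mul (by positivity),
      ENNReal.ofReal_pow hu0, ENNReal.ofReal_pow hu1]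
    congr 3
    · simp
    · rw [← Finset.compl_filter, Finset.card_compl]; simp
  have hpt : ∀ x : Fin n → ℝ, ENNReal.ofReal (φ (countLE x t))
      = ∑ s : Finset (Fin n), (B s).indicator (fun _ => ENNReal.ofReal (φ s.card)) x := by
    intro x
    rw [Finset.sum_eq_single (Finset.univ.filter fun i => x i ≤ t)]
    · rw [Set.indicator_of_mem ((hmem _ _).2 rfl), countLE]
    · intro s _ hs
      exact Set.indicator_of_notMem (fun h => hs ((hmem _ _).1 h)) _
    · simp
  simp_rw [hpt]
  rw [lintegral_finsetSum _ fun s _ => measurable_const.indicator (hB s)]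
  simp_rw [lintegral_indicator_const (hB _), hμB]
  rw [← Finset.powerset_univ, Finset.sum_powerset_apply_card (fun k => ENNReal.ofReal (φ k) *
    ENNReal.ofReal (u ^ k * (1 - u) ^ (n - k))), Finset.card_univ, Fintype.card_fin,
    ENNReal.ofReal_sum_of_nonneg]
  · refine Finset.sum_congr rfl fun k hk => ?_
    rw [nsmul_eq_mul, ← ENNReal.ofReal_mul (hφ k (by simpa [Nat.lt_succ_iff] using hk)),
      ← ENNReal.ofReal_natCast, ← ENNReal.ofReal_mul (by positivity), bern]
    congr 1; ring
  · intro k hk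
    exact mul_nonneg (bern_nonneg n k hu0 (by linarith)) (hφ k (by simpa [Nat.lt_succ_iff] using hk))

lemma measurable_upperPart (n : ℕ) (p a : ℝ) :
    Measurable fun x : Fin n → ℝ => upperPart (empCDF x) p a :=
  Measurable.lintegral_prod_right' (f := fun q : (Fin n → ℝ) × ℝ =>
    ENNReal.ofReal (1 - max p (empCDF q.1 q.2)))
    (measurable_const.sub (measurable_const.max (measurable_empCDF n))).ennreal_ofReal

lemma measurable_lowerPart (n : ℕ) (p a : ℝ) :
    Measurable fun x : Fin n → ℝ => lowerPart (empCDF x) p a :=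
  Measurable.lintegral_prod_right' (f := fun q : (Fin n → ℝ) × ℝ =>
    ENNReal.ofReal (empCDF q.1 q.2 - p))
    ((measurable_empCDF n).sub measurable_const).ennreal_ofReal

lemma lintegral_upperPart (μ : Measure ℝ) [IsProbabilityMeasure μ] {n : ℕ} (hn : n ≠ 0)
    {p : ℝ} (hp1 : p ≤ 1) (a : ℝ) :
    ∫⁻ x, upperPart (empCDF x) p a ∂(Measure.pi fun _ : Fin n => μ)
      = ∫⁻ t in Set.Ioi a, ENNReal.ofReal (1 - cdf μ t - deficit n p (cdf μ t)) := by
  have hn' : (0 : ℝ) < n := by exact_mod_cast Nat.pos_of_ne_zero hn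
  unfold upperPart
  rw [lintegral_lintegral_swap
    (measurable_const.sub (measurable_const.max (measurable_empCDF n))).ennreal_ofReal.aemeasurable]
  refine lintegral_congr fun t => ?_
  simp_rw [empCDF_eq_countLE]
  rw [lintegral_countLE μ n t (fun k => 1 - max p ((k : ℝ) / n))]
  · congr 1
    have : ∀ k ∈ Finset.range (n + 1), bern n k (cdf μ t) * (1 - max p ((k : ℝ) / n))
        = bern n k (cdf μ t) - (1 / (n : ℝ)) * (bern n k (cdf μ t) * k)
          - bern n k (cdf μ t) * max (p - (k : ℝ) / n) 0 := by
      intro k _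
      have : max p ((k : ℝ) / n) = k / n + max (p - (k : ℝ) / n) 0 := by
        rw [← max_add_add_left]; simp
      rw [this]; ring
    rw [Finset.sum_congr rfl this, Finset.sum_sub_distrib, Finset.sum_sub_distrib,
      ← Finset.mul_sum, sum_bern, sum_mul_bern, deficit]
    field_simp
  · intro k hk
    have : (k : ℝ) / n ≤ 1 := by rw [div_le_one hn']; exact_mod_cast hk
    simp [hp1, this]

lemma lintegral_lowerPart (μ : Measure ℝ) [IsProbabilityMeasure μ] (n : ℕ) (p a : ℝ) :
    ∫⁻ x, lowerPart (empCDF x) p a ∂(Measure.pi fun _ : Fin n => μ)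
      = ∫⁻ t in Set.Iio a, ENNReal.ofReal (excess n p (cdf μ t)) := by
  unfold lowerPart
  rw [lintegral_lintegral_swap
    ((measurable_empCDF n).sub measurable_const).ennreal_ofReal.aemeasurable]
  refine lintegral_congr fun t => ?_
  simp_rw [empCDF_eq_countLE]
  rw [excess, ← lintegral_countLE μ n t (fun k => max ((k : ℝ) / n - p) 0)
    fun _ _ => le_max_right _ _]
  refine lintegral_congr fun x => ?_
  rcases le_total ((countLE x t : ℝ) / n - p) 0 with h | h
  · rw [max_eq_right h, ENNReal.ofReal_of_nonpos h, ENNReal.ofReal_zero]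
  · rw [max_eq_left h]

/-- Above a `p`-quantile the upper part is the integral of the survival function. -/
lemma upperPart_cdf {μ : Measure ℝ} {p a : ℝ} (ha : ∀ x, a ≤ x ↔ p ≤ cdf μ x) :
    upperPart (fun x => cdf μ x) p a = ∫⁻ t in Set.Ioi a, ENNReal.ofReal (1 - cdf μ t) := by
  refine setLIntegral_congr_fun measurableSet_Ioi fun t ht => ?_
  have : p ≤ cdf μ t := (ha t).1 (le_of_lt ht)
  simp only [max_eq_right this]

lemma integrableOn_one_sub_cdf {μ : Measure ℝ} {p a : ℝ} (ha : ∀ x, a ≤ x ↔ p ≤ cdf μ x)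
    (hu : upperPart (fun x => cdf μ x) p a ≠ ⊤) :
    IntegrableOn (fun t => 1 - cdf μ t) (Set.Ioi a) := by
  refine ⟨((monotone_cdf μ).measurable.const_sub 1).aestronglyMeasurable, ?_⟩
  rw [hasFiniteIntegral_iff_ofReal (ae_of_all _ fun t => by simpa using cdf_le_one μ t),
    ← upperPart_cdf ha]
  exact hu.lt_top

/-- The expected empirical Tail Value-at-Risk of a sample from `μ`, split at a `p`-quantile. -/
lemma integral_empTVaR (μ : Measure ℝ) [IsProbabilityMeasure μ] {n : ℕ} (hn : n ≠ 0)
    {p a : ℝ} (hp0 : 0 ≤ p) (hp1 : p < 1) (ha : ∀ x, a ≤ x ↔ p ≤ cdf μ x)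
    (hu : upperPart (fun x => cdf μ x) p a ≠ ⊤)
    (hg : Integrable fun x => gap n p (cdf μ x)) :
    Integrable (fun x : Fin n → ℝ => empTVaR p x) (Measure.pi fun _ => μ) ∧
    (∫ x : Fin n → ℝ, empTVaR p x ∂(Measure.pi fun _ => μ)) - tvar (fun x => cdf μ x) p
      = -((1 / (1 - p)) * ∫ x, gap n p (cdf μ x)) := by
  set ν := Measure.pi fun _ : Fin n => μ
  have hF := isDistFun_cdf μ
  have hgn : ∀ x, 0 ≤ gap n p (cdf μ x) := fun x =>
    gap_nonneg hn p (cdf_nonneg μ x) (cdf_le_one μ x)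
  have hU : ∫⁻ x, upperPart (empCDF x) p a ∂ν
      = ∫⁻ t in Set.Ioi a, ENNReal.ofReal (1 - cdf μ t - gap n p (cdf μ t)) := by
    rw [lintegral_upperPart μ hn hp1.le]
    refine setLIntegral_congr_fun measurableSet_Ioi fun t ht => ?_
    have : p ≤ cdf μ t := (ha t).1 (le_of_lt ht)
    simp only [gap_eq_deficit n this]
  have hL : ∫⁻ x, lowerPart (empCDF x) p a ∂ν
      = ∫⁻ t in Set.Iio a, ENNReal.ofReal (gap n p (cdf μ t)) := by
    rw [lintegral_lowerPart μ]
    refine setLIntegral_congr_fun measurableSet_Iio fun t ht => ?_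
    have : cdf μ t ≤ p := le_of_not_ge fun h => absurd ((ha t).2 h) (not_le.2 ht)
    simp only [gap_eq_excess hn this]
  have hF1 := upperPart_cdf ha
  have hF2 : lowerPart (fun x => cdf μ x) p a = 0 := by
    rw [lowerPart, setLIntegral_congr_fun (g := fun _ => 0) measurableSet_Iio]
    · simp
    · intro t ht
      have : cdf μ t ≤ p := le_of_not_ge fun h => absurd ((ha t).2 h) (not_le.2 ht)
      exact ENNReal.ofReal_of_nonpos (by linarith)
  have hi1 := integrableOn_one_sub_cdf ha hu
  have hi2 : IntegrableOn (fun t => 1 - cdf μ t - gap n p (cdf μ t)) (Set.Ioi a) :=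
    hi1.sub hg.integrableOn
  -- On this side the integrand equals `1 - p - excess`, and the excess is at most `1 - p`.
  have hn1 : 0 ≤ᵐ[volume.restrict (Set.Ioi a)] fun t => 1 - cdf μ t - gap n p (cdf μ t) := by
    refine (ae_restrict_iff' measurableSet_Ioi).2 (ae_of_all _ fun t ht => ?_)
    have hle : p ≤ cdf μ t := (ha t).1 (le_of_lt ht)
    have := deficit_sub_excess hn p (cdf μ t)
    have h1 : excess n p (cdf μ t) ≤ 1 - p := by
      have hn' : (0 : ℝ) < n := by exact_mod_cast Nat.pos_of_ne_zero hn
      calc excess n p (cdf μ t) ≤ ∑ k ∈ Finset.range (n + 1), bern n k (cdf μ t) * (1 - p) := by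
            refine Finset.sum_le_sum fun k hk => mul_le_mul_of_nonneg_left ?_
              (bern_nonneg n k (cdf_nonneg μ t) (cdf_le_one μ t))
            have : (k : ℝ) / n ≤ 1 := by
              rw [div_le_one hn']
              exact_mod_cast (by simpa [Nat.lt_succ_iff] using hk : k ≤ n)
            exact max_le (by linarith) (by linarith)
        _ = 1 - p := by rw [← Finset.sum_mul, sum_bern, one_mul]
    simp only [Pi.zero_apply]
    rw [gap_eq_deficit n hle]; linarith
  have hUfin : ∫⁻ x, upperPart (empCDF x) p a ∂ν ≠ ⊤ := by
    rw [hU, ← ofReal_integral_eq_lintegral_ofReal hi2 hn1]; exact ENNReal.ofReal_ne_top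
  have hLfin : ∫⁻ x, lowerPart (empCDF x) p a ∂ν ≠ ⊤ := by
    rw [hL, ← ofReal_integral_eq_lintegral_ofReal hg.integrableOn (ae_of_all _ hgn)]
    exact ENNReal.ofReal_ne_top
  have mU := measurable_upperPart n p a
  have mL := measurable_lowerPart n p a
  have aU := ae_lt_top mU hUfin
  have aL := ae_lt_top mL hLfin
  have iU := integrable_toReal_of_lintegral_ne_top mU.aemeasurable hUfin
  have iL := integrable_toReal_of_lintegral_ne_top mL.aemeasurable hLfin
  have hae : (fun x : Fin n → ℝ => a + (1 / (1 - p)) * ((upperPart (empCDF x) p a).toReal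
      - (lowerPart (empCDF x) p a).toReal)) =ᵐ[ν] fun x => empTVaR p x := by
    filter_upwards [aU, aL] with x h1 h2
    exact (tvar_eq (isDistFun_empCDF hn x) hp0 hp1 a h1.ne h2.ne).symm
  have iD : Integrable (fun x : Fin n → ℝ => (1 / (1 - p)) * ((upperPart (empCDF x) p a).toReal
      - (lowerPart (empCDF x) p a).toReal)) ν := (iU.sub iL).const_mul _
  refine ⟨((integrable_const a).add iD).congr hae, ?_⟩
  rw [← integral_congr_ae hae, integral_add (integrable_const a) iD,
    integral_const_mul, integral_sub iU iL, integral_toReal mU.aemeasurable aU,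
    integral_toReal mL.aemeasurable aL, hU, hL,
    ← integral_eq_lintegral_of_nonneg_ae hn1 hi2.1,
    ← integral_eq_lintegral_of_nonneg_ae (ae_of_all _ hgn) hg.integrableOn.1,
    tvar_eq hF hp0 hp1 a hu (by simp [hF2]), hF1, hF2,
    ← integral_eq_lintegral_of_nonneg_ae (ae_of_all _ fun t => by simpa using cdf_le_one μ t) hi1.1,
    integral_sub hi1 hg.integrableOn,
    ← integral_add_compl (measurableSet_Iio (a := a)) hg, Set.compl_Iio, integral_Ici_eq_integral_Ioi]
  simp
  ring

/-! ### Limit tools -/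

lemma tendsto_mul_pow_sub {ρ : ℝ} (h0 : 0 ≤ ρ) (h1 : ρ < 1) (K : ℕ) :
    Tendsto (fun n : ℕ => (n : ℝ) * ρ ^ (n - K)) atTop (𝓝 0) := by
  rw [← tendsto_add_atTop_iff_nat K]
  have h := (tendsto_self_mul_const_pow_of_lt_one h0 h1).add
    ((tendsto_pow_atTop_nhds_zero_of_lt_one h0 h1).const_mul (K : ℝ))
  rw [mul_zero, add_zero] at h
  refine h.congr fun n => ?_
  rw [Nat.add_sub_cancel]; push_cast; ring

/-- Integrals of functions bounded by `ρ ^ (n - K)` times an integrable function are `o(1 / n)`. -/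
lemma tendsto_mul_setIntegral_of_le {g : ℕ → ℝ → ℝ} {s : Set ℝ} (hs : MeasurableSet s)
    (hg : ∀ n, Measurable (g n)) {w : ℝ → ℝ} (hw : IntegrableOn w s) {ρ : ℝ} (h0 : 0 ≤ ρ)
    (h1 : ρ < 1) (K : ℕ) (hnn : ∀ n, n ≠ 0 → ∀ x ∈ s, 0 ≤ g n x)
    (hle : ∀ n, n ≠ 0 → K ≤ n → ∀ x ∈ s, g n x ≤ ρ ^ (n - K) * w x) :
    (∀ᶠ n in atTop, IntegrableOn (g n) s) ∧
      Tendsto (fun n : ℕ => (n : ℝ) * ∫ x in s, g n x) atTop (𝓝 0) := by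
  have hint : ∀ n, n ≠ 0 → K ≤ n → IntegrableOn (g n) s := by
    intro n hn hK
    refine (hw.const_mul (ρ ^ (n - K))).mono' (hg n).aestronglyMeasurable ?_
    refine (ae_restrict_iff' hs).2 (ae_of_all _ fun x hx => ?_)
    rw [Real.norm_of_nonneg (hnn n hn x hx)]
    exact hle n hn hK x hx
  have hev : ∀ᶠ n : ℕ in atTop, n ≠ 0 ∧ K ≤ n :=
    (eventually_ne_atTop 0).and (eventually_ge_atTop K)
  refine ⟨hev.mono fun n hn => hint n hn.1 hn.2, ?_⟩
  have hlim := (tendsto_mul_pow_sub h0 h1 K).mul_const (∫ x in s, w x)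
  rw [zero_mul] at hlim
  refine squeeze_zero' ?_ ?_ hlim
  · filter_upwards [hev] with n hn
    exact mul_nonneg n.cast_nonneg (setIntegral_nonneg hs (hnn n hn.1))
  · filter_upwards [hev] with n hn
    rw [mul_assoc, ← integral_const_mul (ρ ^ (n - K))]
    exact mul_le_mul_of_nonneg_left (setIntegral_mono_on (hint n hn.1 hn.2)
      (hw.const_mul _) hs (hle n hn.1 hn.2)) n.cast_nonneg

/-- Here `T` is the scaled full integral, `L` its part near `ξ`, and `J` that part weighted by the
density. The neighborhood shrinks with `η`, so `L` and `J` may depend on `η`, while the limit `A` of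
`J` does not. -/
lemma tendsto_div_of_sandwich {T : ℕ → ℝ} {A φ : ℝ} (hφ : 0 < φ)
    (h : ∀ η, 0 < η → η < φ → ∃ L J : ℕ → ℝ, Tendsto (fun n => T n - L n) atTop (𝓝 0) ∧
      Tendsto J atTop (𝓝 A) ∧
      ∀ᶠ n in atTop, (φ - η) * L n ≤ J n ∧ J n ≤ (φ + η) * L n) :
    Tendsto T atTop (𝓝 (A / φ)) := by
  suffices hT : Tendsto (fun n => φ * T n) atTop (𝓝 A) by
    have := hT.div_const φ
    refine this.congr fun n => ?_
    field_simp
  rw [Metric.tendsto_atTop']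
  suffices ∀ e > 0, ∀ᶠ n in atTop, dist (φ * T n) A < e by
    intro e he
    obtain ⟨N, hN⟩ := eventually_atTop.1 (this e he)
    exact ⟨N, fun n hn => hN n hn.le⟩
  intro e he
  set M := |A| + 1 with hM
  have hM0 : 0 < M := by positivity
  -- The first bound gives `φ / 2 * L n ≤ J n < M`; the second then gives `η * L n ≤ e / 2`.
  set η := min (φ / 2) (e * φ / (4 * M)) with hη
  have hη0 : 0 < η := by positivity
  have hη1 : η ≤ φ / 2 := min_le_left _ _
  have hη2 : η * (4 * M) ≤ e * φ := by
    rw [← le_div_iff₀ (by positivity)]; exact min_le_right _ _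
  obtain ⟨L, J, hTL, hJ, hev⟩ := h η hη0 (by linarith)
  have h1 : Tendsto (fun n => |φ * (T n - L n)| + |J n - A|) atTop (𝓝 0) := by
    have a1 := (hTL.const_mul φ).abs
    have a2 := (hJ.sub_const A).abs
    simpa using a1.add a2
  filter_upwards [hev, h1.eventually (gt_mem_nhds (half_pos he)),
    hJ.eventually (gt_mem_nhds (show A < M by linarith [le_abs_self A]))] with n ⟨hn1, hn2⟩ hn3 hn4
  have hLM : φ / 2 * L n ≤ M := by
    rcases le_total 0 (L n) with hL | hL
    · nlinarith
    · nlinarith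
  have hL0 : 0 ≤ L n := by nlinarith
  have hηL : η * L n ≤ e / 2 := by
    have : η * (4 * M) * (φ / 2 * L n) ≤ e * φ * M :=
      mul_le_mul hη2 hLM (by positivity) (by positivity)
    have h3 : (η * L n) * (2 * M * φ) ≤ (e / 2) * (2 * M * φ) := by linarith
    exact le_of_mul_le_mul_right h3 (by positivity)
  have h2 : |φ * L n - J n| ≤ e / 2 := by
    rw [abs_le]; constructor <;> nlinarith
  rw [Real.dist_eq]
  have : φ * T n - A = φ * (T n - L n) + (φ * L n - J n) + (J n - A) := by ring
  rw [this]
  have := abs_add_three (φ * (T n - L n)) (φ * L n - J n) (J n - A)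
  linarith

/-! ### The distribution function where a continuous density exists -/

lemma cdf_eq_add_integral {μ : Measure ℝ} [IsProbabilityMeasure μ] {f : ℝ → ℝ} {U : Set ℝ}
    (hf : HasDensityOn μ f U) (hc : ContinuousOn f U) {a b : ℝ} (hU : Set.Icc a b ⊆ U)
    {x : ℝ} (hx : x ∈ Set.Icc a b) : cdf μ x = cdf μ a + ∫ t in a..x, f t := by
  have hsub : Set.Ioc a x ⊆ U := fun t ht => hU ⟨ht.1.le, ht.2.trans hx.2⟩
  have h1 : μ.real (Set.Ioc a x) = ∫ t in a..x, f t := by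
    rw [intervalIntegral.integral_of_le hx.1, integral_eq_lintegral_of_nonneg_ae,
      Measure.real, hf.2 _ measurableSet_Ioc hsub]
    · exact (ae_restrict_iff' measurableSet_Ioc).2 (ae_of_all _ fun t ht => hf.1 t (hsub ht))
    · exact (hc.mono hsub).aestronglyMeasurable measurableSet_Ioc
  have hd : Disjoint (Set.Iic a) (Set.Ioc a x) :=
    Set.disjoint_left.2 fun t h1 h2 => absurd h2.1 (not_lt.2 h1)
  rw [cdf_eq_real, cdf_eq_real, ← h1, ← measureReal_union hd measurableSet_Ioc,
    Set.Iic_union_Ioc_eq_Iic hx.1]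

lemma continuousOn_cdf {μ : Measure ℝ} [IsProbabilityMeasure μ] {f : ℝ → ℝ} {U : Set ℝ}
    (hf : HasDensityOn μ f U) (hc : ContinuousOn f U) {a b : ℝ} (hab : a ≤ b)
    (hU : Set.Icc a b ⊆ U) : ContinuousOn (fun x => cdf μ x) (Set.Icc a b) := by
  have hci : IntegrableOn f (Set.Icc a b) := (hc.mono hU).integrableOn_Icc
  refine ContinuousOn.congr (f := fun x => cdf μ a + ∫ t in a..x, f t) ?_
    fun x hx => cdf_eq_add_integral hf hc hU hx
  refine continuousOn_const.add ?_
  have := intervalIntegral.continuousOn_primitive_interval (f := f) (μ := volume) (a := a) (b := b)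
    (by rwa [Set.uIcc_of_le hab])
  rwa [Set.uIcc_of_le hab] at this

/-- The substitution `u = F x` where the distribution function `F` has a continuous density. -/
lemma integral_comp_cdf_mul {μ : Measure ℝ} [IsProbabilityMeasure μ] {f : ℝ → ℝ} {U : Set ℝ}
    (hf : HasDensityOn μ f U) (hc : ContinuousOn f U) {a b : ℝ} (hab : a ≤ b)
    (hU : Set.Icc a b ⊆ U) {g : ℝ → ℝ} (hg : Continuous g) :
    ∫ x in a..b, g (cdf μ x) * f x = ∫ u in (cdf μ a)..(cdf μ b), g u := by
  have hcI := hc.mono hU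
  refine intervalIntegral.integral_comp_mul_deriv'' (f := fun x => cdf μ x) (g := g) ?_ ?_ ?_
    hg.continuousOn
  · rw [Set.uIcc_of_le hab]; exact continuousOn_cdf hf hc hab hU
  · rw [min_eq_left hab, max_eq_right hab]
    intro x hx
    have hnx : Set.Icc a b ∈ 𝓝 x := Icc_mem_nhds hx.1 hx.2
    have hd : HasDerivAt (fun y => cdf μ a + ∫ t in a..y, f t) (f x) x := by
      refine (intervalIntegral.integral_hasDerivAt_right ?_ ?_ (hcI.continuousAt hnx)).const_add _
      · exact ((hcI.mono (Set.Icc_subset_Icc_right hx.2.le)).intervalIntegrable_of_Icc hx.1.le)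
      · exact ⟨Set.Icc a b, hnx, hcI.aestronglyMeasurable measurableSet_Icc⟩
    refine (hd.congr_of_eventuallyEq ?_).hasDerivWithinAt
    filter_upwards [hnx] with y hy
    exact cdf_eq_add_integral hf hc hU hy
  · rwa [Set.uIcc_of_le hab]

/-! ### Contribution of the tails -/

/-- Polynomial decay of the lower tail of a law makes high powers of its distribution function
integrable at `-∞`. -/
lemma exists_integrableOn_cdf_pow {μ : Measure ℝ} [IsProbabilityMeasure μ] {C ε b p : ℝ}
    (hε : 0 < ε) (hb : b < 0) (hp : 0 < p) (hC : 0 ≤ C)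
    (hF : ∀ x ≤ b, cdf μ x ≤ C * (-x) ^ (-ε)) (a : ℝ) :
    ∃ K : ℕ, IntegrableOn (fun x => (2 * (cdf μ x) ^ p) ^ K) (Set.Iic a) := by
  -- This makes the exponent `-ε p K` smaller than `-1`, hence integrable at infinity.
  obtain ⟨K, hK⟩ := exists_nat_gt (1 / (ε * p))
  have hK1 : -ε * p * K < -1 := by
    rw [div_lt_iff₀ (by positivity)] at hK; linarith
  have hm : Measurable fun x => (2 * (cdf μ x) ^ p) ^ K :=
    (((monotone_cdf μ).measurable.pow_const p).const_mul 2).pow_const K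
  have h1 : IntegrableOn (fun x => (2 * (cdf μ x) ^ p) ^ K) (Set.Iic b) := by
    have hr : IntegrableOn (fun x : ℝ => (-x) ^ (-ε * p * K)) (Set.Iic b) := by
      have := integrableOn_Ioi_rpow_of_lt hK1 (neg_pos.2 hb)
      have h := this.comp_neg
      rw [integrableOn_Iic_iff_integrableOn_Iio]
      simpa using h
    refine (hr.const_mul ((2 * C ^ p) ^ K)).mono' hm.aestronglyMeasurable ?_
    refine (ae_restrict_iff' measurableSet_Iic).2 (ae_of_all _ fun x hx => ?_)
    have h0 := cdf_nonneg μ x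
    have hx0 : 0 < -x := by have : x ≤ b := hx; linarith
    rw [Real.norm_of_nonneg (by positivity)]
    calc (2 * (cdf μ x) ^ p) ^ K ≤ (2 * (C * (-x) ^ (-ε)) ^ p) ^ K := by
          gcongr; exact hF x hx
      _ = (2 * C ^ p) ^ K * (-x) ^ (-ε * p * K) := by
          rw [Real.mul_rpow hC (by positivity), ← Real.rpow_mul hx0.le, ← mul_assoc, mul_pow,
            Real.rpow_mul_natCast hx0.le]
  have h2 : IntegrableOn (fun x => (2 * (cdf μ x) ^ p) ^ K) (Set.Icc b a) := by
    refine (integrableOn_const (C := (2 : ℝ) ^ K) (by simp)).mono' hm.aestronglyMeasurable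
      (ae_of_all _ fun x => ?_)
    have h0 := cdf_nonneg μ x
    have h1 := Real.rpow_le_one h0 (cdf_le_one μ x) hp.le
    rw [Real.norm_of_nonneg (by positivity)]
    gcongr
    linarith
  exact ⟨K, (h1.union h2).mono_set fun x hx => (le_total x b).imp id fun h => ⟨h, hx⟩⟩

/-- Once `(1 - p) K ≥ 1`, the power of `1 - F ≤ 1` is dominated by `1 - F` itself, so a finite tail
integral suffices. -/
lemma exists_integrableOn_one_sub_cdf_pow {μ : Measure ℝ} {a b p : ℝ} (hp : p < 1) (hab : a ≤ b)
    (hi : IntegrableOn (fun t => 1 - cdf μ t) (Set.Ioi a)) :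
    ∃ K : ℕ, IntegrableOn (fun x => (2 * (1 - cdf μ x) ^ (1 - p)) ^ K) (Set.Ioi b) := by
  obtain ⟨K, hK⟩ := exists_nat_gt (1 / (1 - p))
  have hp' : 0 < 1 - p := by linarith
  have hK1 : 1 ≤ (1 - p) * K := by
    rw [div_lt_iff₀ hp'] at hK; linarith
  refine ⟨K, ((hi.mono_set (Set.Ioi_subset_Ioi hab)).const_mul ((2 : ℝ) ^ K)).mono' ?_
    (ae_of_all _ fun x => ?_)⟩
  · exact ((((monotone_cdf μ).measurable.const_sub 1).pow_const (1 - p)).const_mul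
      2).pow_const K |>.aestronglyMeasurable
  · have h0 : 0 ≤ 1 - cdf μ x := by linarith [cdf_le_one μ x]
    have h1 : 1 - cdf μ x ≤ 1 := by linarith [cdf_nonneg μ x]
    rw [Real.norm_of_nonneg (by positivity), mul_pow, ← Real.rpow_mul_natCast h0]
    gcongr
    calc (1 - cdf μ x) ^ ((1 - p) * K) ≤ (1 - cdf μ x) ^ (1 : ℝ) :=
          Real.rpow_le_rpow_of_exponent_ge' h0 h1 zero_le_one hK1
      _ = _ := Real.rpow_one _

/-- The function `φ` is general because this serves twice: with the distribution function on the
line, and with the identity on `[0, 1]`. -/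
lemma tendsto_gap_lower_tail {p c : ℝ} (hp0 : 0 < p) (hp1 : p < 1) (hc : 0 < c) (hcp : c ≤ p)
    {φ : ℝ → ℝ} (hφ : Measurable φ) {s : Set ℝ} (hs : MeasurableSet s) (h0 : ∀ x ∈ s, 0 ≤ φ x)
    (h1 : ∀ x ∈ s, φ x ≤ p - c) (hK : ∃ K : ℕ, IntegrableOn (fun x => (2 * φ x ^ p) ^ K) s) :
    (∀ᶠ n in atTop, IntegrableOn (fun x => gap n p (φ x)) s) ∧
      Tendsto (fun n : ℕ => (n : ℝ) * ∫ x in s, gap n p (φ x)) atTop (𝓝 0) := by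
  obtain ⟨K, hK⟩ := hK
  obtain ⟨ρ, hρ0, hρ1, hρ⟩ := exists_gap_le hp0 hp1 hc hcp
  exact tendsto_mul_setIntegral_of_le hs (fun n => (continuous_gap n p).measurable.comp hφ) hK
    hρ0.le hρ1 K (fun n hn x hx => gap_nonneg hn p (h0 x hx) (by linarith [h1 x hx]))
    fun n hn hKn x hx => hρ n K hn hKn _ (h0 x hx) (h1 x hx)

lemma tendsto_gap_upper_tail {p c : ℝ} (hp0 : 0 < p) (hp1 : p < 1) (hc : 0 < c) (hcp : c ≤ 1 - p)
    {φ : ℝ → ℝ} (hφ : Measurable φ) {s : Set ℝ} (hs : MeasurableSet s) (h0 : ∀ x ∈ s, φ x ≤ 1)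
    (h1 : ∀ x ∈ s, p + c ≤ φ x)
    (hK : ∃ K : ℕ, IntegrableOn (fun x => (2 * (1 - φ x) ^ (1 - p)) ^ K) s) :
    (∀ᶠ n in atTop, IntegrableOn (fun x => gap n p (φ x)) s) ∧
      Tendsto (fun n : ℕ => (n : ℝ) * ∫ x in s, gap n p (φ x)) atTop (𝓝 0) := by
  obtain ⟨hi, ht⟩ := tendsto_gap_lower_tail (p := 1 - p) (by linarith) (by linarith) hc hcp
    (hφ.const_sub 1) hs (fun x hx => by linarith [h0 x hx]) (fun x hx => by linarith [h1 x hx]) hK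
  constructor
  · filter_upwards [hi, eventually_ne_atTop 0] with n hn hn0
    simp_rw [gap_reflect hn0 p]
    exact hn
  · refine ht.congr' ?_
    filter_upwards [eventually_ne_atTop 0] with n hn0
    simp_rw [gap_reflect hn0 p]

/-! ### Localization at the quantile -/

/-- Only the behaviour near `p` matters for the integral of the gap. -/
lemma tendsto_integral_gap_local {p v w : ℝ} (hv0 : 0 ≤ v) (hvp : v < p) (hpw : p < w)
    (hw1 : w ≤ 1) :
    Tendsto (fun n : ℕ => (n : ℝ) * ∫ u in v..w, gap n p u) atTop (𝓝 (p * (1 - p) / 2)) := by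
  have hp0 : 0 < p := by linarith
  have hp1 : p < 1 := by linarith
  -- On a bounded interval no extra decay is needed, so `K = 0` works.
  have h1 := (tendsto_gap_lower_tail (c := p - v) hp0 hp1 (by linarith) (by linarith)
    measurable_id (measurableSet_Ioc (a := 0) (b := v)) (fun x hx => hx.1.le)
    (fun x hx => by simpa using hx.2) ⟨0, by simp [integrableOn_const_iff]⟩).2
  have h2 := (tendsto_gap_upper_tail (c := w - p) hp0 hp1 (by linarith) (by linarith)
    measurable_id (measurableSet_Ioc (a := w) (b := 1)) (fun x hx => hx.2)
    (fun x hx => by simpa using hx.1.le) ⟨0, by simp [integrableOn_const_iff]⟩).2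
  have h3 := ((tendsto_integral_gap hp0.le hp1.le).sub h1).sub h2
  rw [sub_zero, sub_zero] at h3
  refine h3.congr fun n => ?_
  have hi : ∀ a b, IntervalIntegrable (gap n p) volume a b := fun a b =>
    (continuous_gap n p).intervalIntegrable a b
  rw [← intervalIntegral.integral_add_adjacent_intervals (hi 0 v) (hi v 1),
    ← intervalIntegral.integral_add_adjacent_intervals (hi v w) (hi w 1),
    intervalIntegral.integral_of_le hv0, intervalIntegral.integral_of_le hw1]
  simp only [id]
  ring

/-- A density rules out an atom at `ξ`: values to the left of `ξ` are below `p`, and continuity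
carries this bound to `ξ`. -/
lemma cdf_eq_of_hasDensityOn {μ : Measure ℝ} [IsProbabilityMeasure μ] {p ξ : ℝ}
    (hξ : ∀ x, ξ ≤ x ↔ p ≤ cdf μ x) {f : ℝ → ℝ} {U : Set ℝ} (hU : U ∈ 𝓝 ξ)
    (hf : HasDensityOn μ f U) (hc : ContinuousOn f U) : cdf μ ξ = p := by
  obtain ⟨δ, hδ, hsub⟩ := Metric.nhds_basis_closedBall.mem_iff.1 hU
  rw [Real.closedBall_eq_Icc] at hsub
  have hcont : ContinuousAt (fun x => cdf μ x) ξ :=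
    (continuousOn_cdf hf hc (by linarith) hsub).continuousAt
      (Icc_mem_nhds (by linarith) (by linarith))
  refine le_antisymm ?_ ((hξ ξ).1 le_rfl)
  refine le_of_tendsto (hcont.tendsto.mono_left (nhdsWithin_le_nhds (s := Set.Iio ξ))) ?_
  filter_upwards [self_mem_nhdsWithin] with x hx
  exact le_of_not_ge fun h => absurd ((hξ x).2 h) (not_le.2 hx)

/-- The integrated gap is asymptotically `p (1 - p) / (2 n f(ξ))`. -/
lemma tendsto_integral_gap_cdf {μ : Measure ℝ} [IsProbabilityMeasure μ] {p ξ : ℝ} (hp0 : 0 < p)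
    (hp1 : p < 1) (hξ : ∀ x, ξ ≤ x ↔ p ≤ cdf μ x)
    (hi : IntegrableOn (fun t => 1 - cdf μ t) (Set.Ioi ξ)) {C ε B : ℝ} (hε : 0 < ε) (hB : B < 0)
    (hC : 0 ≤ C) (hF : ∀ x ≤ B, cdf μ x ≤ C * (-x) ^ (-ε)) {f : ℝ → ℝ} {U : Set ℝ}
    (hU : U ∈ 𝓝 ξ) (hf : HasDensityOn μ f U) (hc : ContinuousOn f U) (hpos : 0 < f ξ) :
    (∀ᶠ n in atTop, Integrable fun x => gap n p (cdf μ x)) ∧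
      Tendsto (fun n : ℕ => (n : ℝ) * ∫ x, gap n p (cdf μ x)) atTop
        (𝓝 (p * (1 - p) / 2 / f ξ)) := by
  have hmF : Measurable fun x => cdf μ x := (monotone_cdf μ).measurable
  have hFξ := cdf_eq_of_hasDensityOn hξ hU hf hc
  have key : ∀ η, 0 < η → η < f ξ → ∃ a b, a < ξ ∧ ξ < b ∧ Set.Icc a b ⊆ U ∧
      (∀ x ∈ Set.Icc a b, f ξ - η ≤ f x ∧ f x ≤ f ξ + η) ∧ cdf μ a < p ∧ p < cdf μ b := by
    intro η hη hηf
    have hV : {x | f x ∈ Set.Icc (f ξ - η) (f ξ + η)} ∈ 𝓝 ξ :=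
      (hc.continuousAt hU).preimage_mem_nhds (Icc_mem_nhds (by linarith) (by linarith))
    obtain ⟨δ, hδ, hsub⟩ := Metric.nhds_basis_closedBall.mem_iff.1 (inter_mem hU hV)
    rw [Real.closedBall_eq_Icc] at hsub
    have hsU : Set.Icc (ξ - δ) (ξ + δ) ⊆ U := fun x hx => (hsub hx).1
    refine ⟨ξ - δ, ξ + δ, by linarith, by linarith, hsU, fun x hx => (hsub hx).2, ?_, ?_⟩
    · exact not_le.1 fun h => absurd ((hξ _).2 h) (by linarith)
    · have hsR : Set.Icc ξ (ξ + δ) ⊆ Set.Icc (ξ - δ) (ξ + δ) :=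
        Set.Icc_subset_Icc_left (by linarith)
      rw [cdf_eq_add_integral hf hc (hsR.trans hsU) (Set.right_mem_Icc.2 (by linarith)), hFξ,
        lt_add_iff_pos_right]
      -- Strict growth to the right of `ξ` comes from `f ≥ f ξ - η > 0`; it keeps the upper tail at
      -- a fixed distance from `p`.
      refine intervalIntegral.intervalIntegral_pos_of_pos_on
        ((hc.mono (hsR.trans hsU)).intervalIntegrable_of_Icc (by linarith)) (fun x hx => ?_)
        (by linarith)
      have := (hsub (hsR (Set.Ioo_subset_Icc_self hx))).2.1
      linarith
  have tails : ∀ a b, a < ξ → ξ < b → cdf μ a < p → p < cdf μ b →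
      (∀ᶠ n in atTop, Integrable fun x => gap n p (cdf μ x)) ∧
      Tendsto (fun n : ℕ => (n : ℝ) * (∫ x, gap n p (cdf μ x))
        - n * ∫ x in a..b, gap n p (cdf μ x)) atTop (𝓝 0) := by
    intro a b haξ hξb hpa hpb
    obtain ⟨il, tl⟩ := tendsto_gap_lower_tail (c := p - cdf μ a) hp0 hp1 (by linarith)
      (by linarith [cdf_nonneg μ a]) hmF (measurableSet_Iic (a := a)) (fun x _ => cdf_nonneg μ x)
      (fun x hx => by linarith [monotone_cdf μ (show x ≤ a from hx)])
      (exists_integrableOn_cdf_pow hε hB hp0 hC hF a)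
    obtain ⟨iu, tu⟩ := tendsto_gap_upper_tail (c := cdf μ b - p) hp0 hp1 (by linarith)
      (by linarith [cdf_le_one μ b]) hmF (measurableSet_Ioi (a := b)) (fun x _ => cdf_le_one μ x)
      (fun x hx => by linarith [monotone_cdf μ (le_of_lt (show b < x from hx))])
      (exists_integrableOn_one_sub_cdf_pow hp1 hξb.le hi)
    have hab : a ≤ b := by linarith
    have hmid : ∀ n, IntegrableOn (fun x => gap n p (cdf μ x)) (Set.Ioc a b) := by
      intro n
      obtain ⟨M, hM⟩ := isCompact_Icc.exists_bound_of_continuousOn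
        (continuous_gap n p).continuousOn (s := Set.Icc 0 1)
      refine (integrableOn_const (C := M) (by simp)).mono'
        ((continuous_gap n p).measurable.comp hmF).aestronglyMeasurable (ae_of_all _ fun x => ?_)
      exact hM _ ⟨cdf_nonneg μ x, cdf_le_one μ x⟩
    have hIic : ∀ᶠ n in atTop, IntegrableOn (fun x => gap n p (cdf μ x)) (Set.Iic b) := by
      filter_upwards [il] with n hn
      rw [← Set.Iic_union_Ioc_eq_Iic hab]
      exact hn.union (hmid n)
    have hall : ∀ᶠ n in atTop, Integrable fun x => gap n p (cdf μ x) := by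
      filter_upwards [hIic, iu] with n h1 h2
      rw [← integrableOn_univ, ← Set.Iic_union_Ioi (a := b)]
      exact h1.union h2
    refine ⟨hall, ?_⟩
    have h := tl.add tu
    rw [add_zero] at h
    refine h.congr' ?_
    filter_upwards [hIic, il, hall] with n h1 h2 h3
    rw [← intervalIntegral.integral_Iic_sub_Iic h2 h1,
      ← integral_add_compl (measurableSet_Iic (a := b)) h3, Set.compl_Iic]
    ring
  constructor
  · obtain ⟨a, b, h1, h2, -, -, h3, h4⟩ := key (f ξ / 2) (by linarith) (by linarith)
    exact (tails a b h1 h2 h3 h4).1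
  · refine tendsto_div_of_sandwich hpos fun η hη hηf => ?_
    obtain ⟨a, b, h1, h2, hsU, hfη, h3, h4⟩ := key η hη hηf
    have hab : a ≤ b := by linarith
    refine ⟨fun n => n * ∫ x in a..b, gap n p (cdf μ x),
      fun n => n * ∫ u in (cdf μ a)..(cdf μ b), gap n p u, (tails a b h1 h2 h3 h4).2,
      tendsto_integral_gap_local (cdf_nonneg μ a) h3 h4 (cdf_le_one μ b), ?_⟩
    filter_upwards [eventually_ne_atTop 0] with n hn
    have hcg : ContinuousOn (fun x => gap n p (cdf μ x)) (Set.Icc a b) :=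
      (continuous_gap n p).comp_continuousOn (continuousOn_cdf hf hc hab hsU)
    have hcf := hc.mono hsU
    have hii : ∀ {g : ℝ → ℝ}, ContinuousOn g (Set.Icc a b) → IntervalIntegrable g volume a b :=
      fun h => h.intervalIntegrable_of_Icc hab
    have hg0 : ∀ x, 0 ≤ gap n p (cdf μ x) := fun x =>
      gap_nonneg hn p (cdf_nonneg μ x) (cdf_le_one μ x)
    rw [← integral_comp_cdf_mul hf hc hab hsU (continuous_gap n p)]
    constructor
    · rw [mul_left_comm, ← intervalIntegral.integral_const_mul (f ξ - η)]
      refine mul_le_mul_of_nonneg_left (intervalIntegral.integral_mono_on hab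
        (hii (continuousOn_const.mul hcg)) (hii (hcg.mul hcf)) fun x hx => ?_) n.cast_nonneg
      rw [mul_comm]
      exact mul_le_mul_of_nonneg_left (hfη x hx).1 (hg0 x)
    · rw [mul_left_comm, ← intervalIntegral.integral_const_mul (f ξ + η)]
      refine mul_le_mul_of_nonneg_left (intervalIntegral.integral_mono_on hab
        (hii (hcg.mul hcf)) (hii (continuousOn_const.mul hcg)) fun x hx => ?_) n.cast_nonneg
      rw [mul_comm (f ξ + η)]
      exact mul_le_mul_of_nonneg_left (hfη x hx).2 (hg0 x)

/-- Markov's inequality for the lower tail of a variable with a truncated moment. -/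
lemma exists_cdf_le_rpow {Ω : Type*} [MeasurableSpace Ω] {P : Measure Ω} [IsProbabilityMeasure P]
    {X : Ω → ℝ} (hX : AEMeasurable X P) {ξ ε : ℝ} (hε : 0 < ε)
    (h : Integrable (Set.indicator {ω | X ω ≤ ξ} (fun ω => |X ω| ^ ε)) P) :
    ∃ C B : ℝ, 0 ≤ C ∧ B < 0 ∧ ∀ x ≤ B, cdf (P.map X) x ≤ C * (-x) ^ (-ε) := by
  have : IsProbabilityMeasure (P.map X) := Measure.isProbabilityMeasure_map hX
  have hnn : 0 ≤ Set.indicator {ω | X ω ≤ ξ} (fun ω => |X ω| ^ ε) :=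
    fun ω => Set.indicator_nonneg (fun _ _ => by positivity) ω
  -- Below `min (-1) ξ` the base `-x` is positive and `{X ≤ x}` lies where the truncation is
  -- inactive.
  refine ⟨∫ ω, Set.indicator {ω | X ω ≤ ξ} (fun ω => |X ω| ^ ε) ω ∂P, min (-1) ξ,
    integral_nonneg hnn, by linarith [min_le_left (-1) ξ], fun x hx => ?_⟩
  have hx0 : 0 < -x := by linarith [min_le_left (-1) ξ]
  have hxξ : x ≤ ξ := hx.trans (min_le_right _ _)
  rw [Real.rpow_neg hx0.le, ← div_eq_mul_inv, le_div_iff₀ (by positivity), mul_comm]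
  refine le_trans ?_ (mul_meas_ge_le_integral_of_nonneg (ae_of_all _ hnn) h ((-x) ^ ε))
  refine mul_le_mul_of_nonneg_left ?_ (by positivity)
  rw [cdf_eq_real, map_measureReal_apply_of_aemeasurable hX measurableSet_Iic]
  refine measureReal_mono fun ω hω => ?_
  have hω' : X ω ≤ x := hω
  have hm : ω ∈ {ω | X ω ≤ ξ} := hω'.trans hxξ
  simp only [Set.mem_ofPred_eq]
  rw [Set.indicator_of_mem hm, abs_of_nonpos (by linarith)]
  exact Real.rpow_le_rpow hx0.le (by linarith) hε.le

lemma map_sample_eq_pi {Ω : Type*} [MeasurableSpace Ω] {P : Measure Ω} [IsProbabilityMeasure P]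
    {S : ℕ → Ω → ℝ} {μ : Measure ℝ} (hindep : iIndepFun S P) (hm : ∀ i, AEMeasurable (S i) P)
    (hS : ∀ i, P.map (S i) = μ) (n : ℕ) :
    P.map (fun ω (i : Fin n) => S i ω) = Measure.pi fun _ => μ := by
  have h := hindep.precomp (g := fun i : Fin n => (i : ℕ)) Fin.val_injective
  rw [(iIndepFun_iff_map_fun_eq_pi_map fun i : Fin n => hm i).1 h]
  simp_rw [hS]

end EmpTVaR

/-! ### The bias expansion -/

theorem theorem1 {Ω₀ Ω : Type*} [MeasurableSpace Ω₀] [MeasurableSpace Ω]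
    -- the random variable `X`, and an iid sequence `S` of copies of it
    (P₀ : Measure Ω₀) [IsProbabilityMeasure P₀] (X : Ω₀ → ℝ)
    (P : Measure Ω) [IsProbabilityMeasure P] (S : ℕ → Ω → ℝ)
    (hindep : iIndepFun S P) (hident : ∀ i, IdentDistrib (S i) X P P₀)
    -- the distribution function of `X`, the level `p` and the quantile at level `p`
    (F : ℝ → ℝ) (hF : F = fun x => cdf (P₀.map X) x)
    (p : ℝ) (hp : p ∈ Set.Ioo (0 : ℝ) 1)
    (ξ : ℝ) (hξ : ξ = EmpTVaR.quantile F p)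
    -- finiteness of the tail integral of the quantile function
    (hC1 : IntegrableOn (EmpTVaR.quantile F) (Set.Ioo p 1) volume)
    -- a finite moment of some positive order of the lower part
    (hC2 : ∃ ε : ℝ, 0 < ε ∧
      Integrable (Set.indicator {ω | X ω ≤ ξ} (fun ω => |X ω| ^ ε)) P₀)
    -- a density that exists and is continuous in a neighborhood of `ξ`, positive at `ξ`
    (f : ℝ → ℝ)
    (hf : ∃ U ∈ 𝓝 ξ, EmpTVaR.HasDensityOn (P₀.map X) f U ∧ ContinuousOn f U)
    (hfpos : 0 < f ξ) :
    (∀ᶠ n : ℕ in atTop, Integrable (fun ω => EmpTVaR.empTVaR p (fun i : Fin n => S i ω)) P) ∧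
      (fun n : ℕ => EmpTVaR.bias P S F p n - (-(p / (2 * (n : ℝ) * f ξ))))
        =o[atTop] (fun n : ℕ => (1 : ℝ) / (n : ℝ)) := by
  open EmpTVaR in
  obtain ⟨hp0, hp1⟩ := hp
  obtain ⟨ε, hε, hm⟩ := hC2
  obtain ⟨U, hU, hdens, hcont⟩ := hf
  have hX : AEMeasurable X P₀ := (hident 0).aemeasurable_snd
  set μ := P₀.map X with hμ
  have : IsProbabilityMeasure μ := Measure.isProbabilityMeasure_map hX
  have hG : IsDistFun F := hF ▸ isDistFun_cdf μ
  have hq : ∀ x, ξ ≤ x ↔ p ≤ cdf μ x := by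
    intro x
    rw [hξ, quantile_le_iff hG hp0 hp1, hF]
  have hup : upperPart (fun x => cdf μ x) p ξ ≠ ⊤ := by
    rw [← hF]; exact upperPart_ne_top hG hp0.le ξ hC1
  obtain ⟨C, B, hC, hB, hCB⟩ := exists_cdf_le_rpow hX hε hm
  obtain ⟨hint, hlim⟩ := tendsto_integral_gap_cdf hp0 hp1 hq (integrableOn_one_sub_cdf hq hup) hε
    hB hC hCB hU hdens hcont hfpos
  have hmS : ∀ n, AEMeasurable (fun ω (i : Fin n) => S i ω) P := fun n =>
    aemeasurable_pi_lambda _ fun i => (hident i).aemeasurable_fst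
  have hmap := map_sample_eq_pi hindep (fun i => (hident i).aemeasurable_fst)
    fun i => (hident i).map_eq
  have hmain : ∀ᶠ n : ℕ in atTop,
      Integrable (fun ω => empTVaR p (fun i : Fin n => S i ω)) P ∧
      bias P S F p n = -((1 / (1 - p)) * ∫ x, gap n p (cdf μ x)) := by
    filter_upwards [hint, eventually_ne_atTop 0] with n hn hn0
    obtain ⟨h1, h2⟩ := integral_empTVaR μ hn0 hp0.le hp1 hq hup hn
    rw [← hmap n] at h1 h2
    refine ⟨(integrable_map_measure h1.1 (hmS n)).1 h1, ?_⟩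
    rw [← h2, bias, hF, integral_map (hmS n) h1.1]
  refine ⟨hmain.mono fun n hn => hn.1, ?_⟩
  rw [isLittleO_iff_tendsto']
  · have hl := (hlim.const_mul (-(1 / (1 - p)))).add_const (p / (2 * f ξ))
    -- The factor `1 - p` from the variance term cancels the normalization of the Tail
    -- Value-at-Risk.
    have h0 : -(1 / (1 - p)) * (p * (1 - p) / 2 / f ξ) + p / (2 * f ξ) = 0 := by
      have : 1 - p ≠ 0 := by linarith
      field_simp
      ring
    rw [h0] at hl
    refine hl.congr' ?_
    filter_upwards [hmain, eventually_ne_atTop 0] with n hn hn0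
    have hn' : (n : ℝ) ≠ 0 := by exact_mod_cast hn0
    rw [hn.2]
    field_simp
    ring
  · filter_upwards [eventually_ne_atTop 0] with n hn h
    have hn' : (n : ℝ) ≠ 0 := by exact_mod_cast hn
    exact absurd h (by positivity)
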